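/- Let $T$ be a finite tree with vertex set $V$, and let $\chi : V \to \{\mathcal R, \mathcal B\}$ be a 2-coloring of $T$ (adjacent vertices receive different colors). For a finite simple graph $G$ and $S \subseteq V(G)$, let $N_G(S) = \bigcup_{v \in S} N_G(v)$ and $N_G[S] = N_G(S) \cup S$. A set $D \subseteq V(G)$ is a total dominating set of $G$ if $N_G(D) = V(G)$; it is minimal if no proper subset of $D$ is a total dominating set; and $G$ is unmixed if all minimal total dominating sets of $G$ have the same size. A leaf is a vertex of degree 1. The height of a vertex is $0$ if it is isolated, and otherwise its smallest distance in $G$ to a leaf of $G$. Write $V_k(G)$ for the set of vertices of height $k$, and $\mathrm{height}(G)$ for the largest $k$ with $V_k(G) \ne \emptyset$. For $C \in \{\mathcal R, \mathcal B\}$, the interior graph $T_C$ of $T$ is the subgraph of $T$ induced by $V \setminus N_T[V_1(T) \cap \chi^{-1}(C)]$. Theorem. The tree $T$ is unmixed if and only if every connected component $T'$ of $T_{\mathcal B}$ and every connected component $T'$ of $T_{\mathcal R}$ satisfies the following conditions, in which heights and neighborhoods are taken in $T'$: 1. $\mathrm{height}(T') \le 3$; 2. for all $v \in V_2(T')$,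 $|N_{T'}(v) \cap V_1(T')| = 1$; 3. for all $v \in V_1(T')$, $|N_{T'}(v) \cap V_2(T')| \le 1$. -/

import Mathlib

namespace UnmixedTree

universe u

/-- The two colors of a 2-coloring. -/
inductive Color : Type
  | red : Color
  | blue : Color

section Graph

variable {V : Type u} (G : SimpleGraph V)

/-- The open neighborhood `N(S)`, the union of the `N(v)` for `v ∈ S`. -/
def openNbhd (S : Set V) : Set V := ⋃ v ∈ S, G.neighborSet v

/-- The closed neighborhood `N[S] = N(S) ∪ S`. -/
def closedNbhd (S : Set V) : Set V := openNbhd G S ∪ S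

/-- `D` is a total dominating set: `N(D) = V`. -/
def IsTDSet (D : Set V) : Prop := openNbhd G D = Set.univ

/-- `D` is a total dominating set that contains no smaller total dominating set. -/
def IsMinimalTDSet (D : Set V) : Prop := Minimal (IsTDSet G) D

/-- All minimal total dominating sets have the same size. -/
def Unmixed : Prop :=
  ∀ D D' : Set V, IsMinimalTDSet G D → IsMinimalTDSet G D' → D.encard = D'.encard

/-- An isolated vertex: a vertex of degree 0. -/
def IsIsolated (v : V) : Prop := (G.neighborSet v).encard = 0

/-- A leaf: a vertex of degree 1. -/
def IsLeaf (v : V) : Prop := (G.neighborSet v).encard = 1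

open Classical in
/-- The height of a vertex: the smallest distance to a leaf, and 0 if the vertex is isolated.
The value is `⊤` if `v` is not isolated and no leaf can be reached from it; this does not occur
in a finite forest. -/
noncomputable def height (v : V) : ℕ∞ :=
  if IsIsolated G v then 0 else ⨅ l ∈ {l : V | IsLeaf G l}, G.edist v l

/-- `V_k(G)`, the set of vertices of height `k`. -/
def level (k : ℕ) : Set V := {v : V | height G v = (k : ℕ∞)}

/-- The height of a graph, i.e. the largest `k` with `V_k(G) ≠ ∅` (the set of these `k` is finite
when the graph is finite). -/
noncomputable def graphHeight : ℕ := sSup {k : ℕ | (level G k).Nonempty}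

variable {G}

/-- The vertex set `V \ N[V_1 ∩ χ⁻¹(c)]` of the interior graph of color `c`. -/
def interiorSet (χ : G.Coloring Color) (c : Color) : Set V :=
  (closedNbhd G (level G 1 ∩ χ ⁻¹' {c}))ᶜ

/-- The interior graph of color `c`: the induced subgraph on `V \ N[V_1 ∩ χ⁻¹(c)]`. -/
def interiorGraph (χ : G.Coloring Color) (c : Color) : SimpleGraph (interiorSet χ c) :=
  G.induce (interiorSet χ c)

end Graph

end UnmixedTree

/-! Suppose that the tree has at least three vertices. A leaf is dominated only by its neighbor, so
every total dominating set contains `V_1`. It remains to dominate the vertices with no neighbor in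
`V_1`. Since neighbors have opposite colors, this splits into two independent transversal problems,
one per interior graph: in the graph of color `c` the vertices of color `c` are the points, and each
vertex `a` of the other color stands for the hyperedge `N(a)`. Hence `T` is unmixed exactly when,
for each color, all minimal transversals have the same size (`isMinTransversal_univ_iff`,
`unmixed_iff_forall_transversalUnmixed`).

The core is a statement about forests whose hyperedges have at least two points: minimal
transversals all have the same size if and only if the hypergraph is grafted
(`IsForestHeight.transversalUnmixed_iff`). If it is grafted, a minimal transversal has exactly one
point in each pendant hyperedge and none elsewhere. Conversely, a König argument gives a matching
`M` as large as every minimal transversal, so each of these meets each `m ∈ M` exactly once and lies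
in the union of `M`. Transversals adapted to chosen hyperedges exist because there are no short
cycles. They show that `M` covers all points and that each `m ∈ M` has at most one point that is not
a leaf, so `M` is the set of pendant hyperedges.

Being grafted can be checked on each component (`isGrafted_iff_forall`). There every leaf is a
point, so the parity of the distance to a leaf turns the condition into the three height conditions
(`isGrafted_iff_level`). -/

namespace UnmixedTree

/-! ### Transversals of neighborhoods in a forest -/

section Hypergraph

variable {V : Type*} {G : SimpleGraph V}

/-- `h` orients a forest: every vertex has at most one neighbor that is not higher. -/
def IsForestHeight (G : SimpleGraph V) (h : V → ℕ) : Prop :=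
  ∀ v u w, G.Adj v u → G.Adj v w → h u ≤ h v → h w ≤ h v → u = w

theorem _root_.SimpleGraph.IsTree.isForestHeight_dist (hG : G.IsTree) (r : V) :
    IsForestHeight G (G.dist r) := by
  intro v u w hu hw hlu hlw
  have key : ∀ u, G.Adj v u → G.dist r u ≤ G.dist r v →
      ∀ p : G.Walk r v, p.IsPath → u = p.penultimate := by
    intro u hu hlu p hp
    obtain ⟨q, hq, hql⟩ := hG.connected.exists_path_of_dist r u
    -- Adjacent vertices have different distances to `r`, so `u` is strictly closer and a geodesic
    -- to `u` avoids `v`. Extended by `v`, it is the unique path from `r` to `v`.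
    have hv : v ∉ q.support := by
      intro hv
      classical
      have h1 := SimpleGraph.dist_le (q.takeUntil v hv)
      have h2 := q.length_takeUntil_le_length hv
      have h3 := hG.dist_ne_of_adj r hu
      omega
    have := (hG.isAcyclic.subsingleton_path r v).elim ⟨p, hp⟩
      ⟨q.concat hu.symm, hq.concat hv hu.symm⟩
    have h2 : p = q.concat hu.symm := congrArg Subtype.val this
    rw [h2, SimpleGraph.Walk.penultimate_concat]
  obtain ⟨p, hp, -⟩ := hG.connected.exists_path_of_dist r v
  rw [key u hu hlu p hp, key w hw hlw p hp]

/-- A highest vertex of a cycle would have two distinct neighbors that are not higher. -/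
theorem IsForestHeight.no_four_cycle {h : V → ℕ} (hh : IsForestHeight G h) {a b x y : V}
    (hax : G.Adj a x) (hay : G.Adj a y) (hbx : G.Adj b x) (hby : G.Adj b y) (hxy : x ≠ y) :
    a = b := by
  by_contra hab
  have h1 : ¬ (h x ≤ h a ∧ h y ≤ h a) := fun k => hxy (hh a x y hax hay k.1 k.2)
  have h2 : ¬ (h x ≤ h b ∧ h y ≤ h b) := fun k => hxy (hh b x y hbx hby k.1 k.2)
  have h3 : ¬ (h a ≤ h x ∧ h b ≤ h x) := fun k => hab (hh x a b hax.symm hbx.symm k.1 k.2)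
  have h4 : ¬ (h a ≤ h y ∧ h b ≤ h y) := fun k => hab (hh y a b hay.symm hby.symm k.1 k.2)
  omega

/-- Again a highest vertex gives the contradiction. Only backtracking is excluded: the eight
vertices need not be distinct. -/
theorem IsForestHeight.no_eight_cycle {h : V → ℕ} (hh : IsForestHeight G h)
    {g f₁ m f₂ p x₁ x₂ q : V}
    (hgp : G.Adj g p) (hfp : G.Adj f₁ p) (hfx : G.Adj f₁ x₁) (hmx : G.Adj m x₁)
    (hmx' : G.Adj m x₂) (hfx' : G.Adj f₂ x₂) (hfq : G.Adj f₂ q) (hgq : G.Adj g q)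
    (h₁ : g ≠ f₁) (h₂ : p ≠ x₁) (h₃ : f₁ ≠ m) (h₄ : x₁ ≠ x₂) (h₅ : f₂ ≠ m) (h₆ : q ≠ x₂)
    (h₇ : g ≠ f₂) (h₈ : p ≠ q) : False := by
  have k1 : ¬ (h g ≤ h p ∧ h f₁ ≤ h p) := fun k => h₁ (hh p g f₁ hgp.symm hfp.symm k.1 k.2)
  have k2 : ¬ (h p ≤ h f₁ ∧ h x₁ ≤ h f₁) := fun k => h₂ (hh f₁ p x₁ hfp hfx k.1 k.2)
  have k3 : ¬ (h f₁ ≤ h x₁ ∧ h m ≤ h x₁) := fun k => h₃ (hh x₁ f₁ m hfx.symm hmx.symm k.1 k.2)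
  have k4 : ¬ (h x₁ ≤ h m ∧ h x₂ ≤ h m) := fun k => h₄ (hh m x₁ x₂ hmx hmx' k.1 k.2)
  have k5 : ¬ (h f₂ ≤ h x₂ ∧ h m ≤ h x₂) := fun k => h₅ (hh x₂ f₂ m hfx'.symm hmx'.symm k.1 k.2)
  have k6 : ¬ (h q ≤ h f₂ ∧ h x₂ ≤ h f₂) := fun k => h₆ (hh f₂ q x₂ hfq hfx' k.1 k.2)
  have k7 : ¬ (h g ≤ h q ∧ h f₂ ≤ h q) := fun k => h₇ (hh q g f₂ hgq.symm hfq.symm k.1 k.2)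
  have k8 : ¬ (h p ≤ h g ∧ h q ≤ h g) := fun k => h₈ (hh g p q hgp hgq k.1 k.2)
  omega

/-- `D` meets the neighborhood of every vertex of `A`. -/
def IsTransversal (G : SimpleGraph V) (A D : Set V) : Prop :=
  ∀ a ∈ A, ∃ d ∈ D, G.Adj a d

/-- A transversal that contains no smaller one. -/
def IsMinTransversal (G : SimpleGraph V) (A D : Set V) : Prop :=
  Minimal (IsTransversal G A) D

/-- All minimal transversals of the neighborhoods of `A` have the same size. -/
def TransversalUnmixed (G : SimpleGraph V) (A : Set V) : Prop :=
  ∀ D D' : Set V, IsMinTransversal G A D → IsMinTransversal G A D' → D.encard = D'.encard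

/-- A point can be dropped unless some hyperedge is met by it alone. Minimality is mostly used
through these private hyperedges. -/
theorem isMinTransversal_iff {A D : Set V} :
    IsMinTransversal G A D ↔ IsTransversal G A D ∧
      ∀ d ∈ D, ∃ a ∈ A, G.Adj a d ∧ ∀ d' ∈ D, G.Adj a d' → d' = d := by
  constructor
  · intro h
    refine ⟨h.prop, fun d hd => ?_⟩
    by_contra hcon
    push Not at hcon
    have : IsTransversal G A (D \ {d}) := by
      intro a ha
      obtain ⟨x, hx, hax⟩ := h.prop a ha
      by_cases hxd : x = d
      · subst hxd
        obtain ⟨y, hy, hay, hne⟩ := hcon a ha hax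
        exact ⟨y, ⟨hy, hne⟩, hay⟩
      · exact ⟨x, ⟨hx, hxd⟩, hax⟩
    exact (h.le_of_le this Set.sdiff_subset hd).2 rfl
  · rintro ⟨h1, h2⟩
    refine ⟨h1, fun E hE hED d hd => ?_⟩
    obtain ⟨a, ha, -, hp⟩ := h2 d hd
    obtain ⟨e, he, hae⟩ := hE a ha
    exact hp e (hED he) hae ▸ he

theorem IsTransversal.exists_min_subset [Finite V] {A D : Set V} (h : IsTransversal G A D) :
    ∃ E ⊆ D, IsMinTransversal G A E :=
  exists_minimal_le_of_wellFoundedLT _ D h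

/-- Every vertex of `A` has at least two neighbors. -/
def HasTwoNeighbors (G : SimpleGraph V) (A : Set V) : Prop :=
  ∀ a ∈ A, ∃ x y, x ≠ y ∧ G.Adj a x ∧ G.Adj a y

/-- `x` has exactly one neighbor in `A`. -/
def IsLeafFor (G : SimpleGraph V) (A : Set V) (x : V) : Prop :=
  ∃! a, a ∈ A ∧ G.Adj a x

/-- `m` belongs to `A` and has a neighbor that is a leaf with respect to `A`. -/
def IsPendant (G : SimpleGraph V) (A : Set V) (m : V) : Prop :=
  m ∈ A ∧ ∃ l, G.Adj m l ∧ IsLeafFor G A l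

/-- Each vertex next to `A` has exactly one pendant neighbor, and each pendant vertex has at most
one neighbor that is not a leaf. -/
def IsGrafted (G : SimpleGraph V) (A : Set V) : Prop :=
  (∀ x, (∃ a ∈ A, G.Adj a x) → ∃! m, IsPendant G A m ∧ G.Adj m x) ∧
  ∀ m, IsPendant G A m → ∀ x y, G.Adj m x → G.Adj m y →
    ¬ IsLeafFor G A x → ¬ IsLeafFor G A y → x = y

/-- A relation matching the elements of `D` with those of `M` bijectively. -/
theorem encard_eq_of_existsUnique {α β : Type*} {M : Set α} {D : Set β} {r : α → β → Prop}
    (h1 : ∀ m ∈ M, ∃! d, d ∈ D ∧ r m d) (h2 : ∀ d ∈ D, ∃! m, m ∈ M ∧ r m d) :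
    M.encard = D.encard := by
  rcases isEmpty_or_nonempty β with _ | _
  · rw [Set.eq_empty_of_forall_notMem fun m hm => isEmptyElim (h1 m hm).choose,
      Set.eq_empty_of_isEmpty D, Set.encard_empty, Set.encard_empty]
  choose! f hf hf' using h1
  have hinj : Set.InjOn f M := by
    intro m hm m' hm' he
    exact (h2 _ (hf m hm).1).unique ⟨hm, (hf m hm).2⟩ ⟨hm', he ▸ (hf m' hm').2⟩
  rw [← hinj.encard_image]
  congr 1
  refine Set.Subset.antisymm (Set.image_subset_iff.2 fun m hm => (hf m hm).1) fun d hd => ?_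
  obtain ⟨m, ⟨hm, hr⟩, -⟩ := h2 d hd
  exact ⟨m, hm, (hf' m hm d ⟨hd, hr⟩).symm⟩

/-- Every minimal transversal is in bijection with the pendant vertices. If a pendant `m` contains a
chosen leaf, then `m` is the private hyperedge of that leaf, so nothing else in `m` is chosen;
otherwise the single non-leaf of `m` is chosen. -/
theorem IsGrafted.transversalUnmixed {A : Set V} (hA : IsGrafted G A) :
    TransversalUnmixed G A := by
  have key : ∀ D, IsMinTransversal G A D → {m | IsPendant G A m}.encard = D.encard := by
    intro D hD
    rw [isMinTransversal_iff] at hD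
    obtain ⟨ht, hp⟩ := hD
    have leaf : ∀ m, IsPendant G A m → ∀ d ∈ D, ∀ d' ∈ D, G.Adj m d → G.Adj m d' →
        IsLeafFor G A d → d' = d := by
      intro m hm d hd d' hd' hmd hmd' hl
      obtain ⟨a, ha, had, hpr⟩ := hp d hd
      obtain rfl := hl.unique ⟨ha, had⟩ ⟨hm.1, hmd⟩
      exact hpr d' hd' hmd'
    refine encard_eq_of_existsUnique (r := G.Adj) ?_ ?_
    · intro m hm
      obtain ⟨d, hd, hmd⟩ := ht m hm.1
      refine ⟨d, ⟨hd, hmd⟩, ?_⟩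
      rintro d' ⟨hd', hmd'⟩
      by_cases hl : IsLeafFor G A d
      · exact leaf m hm d hd d' hd' hmd hmd' hl
      by_cases hl' : IsLeafFor G A d'
      · exact (leaf m hm d' hd' d hd hmd' hmd hl').symm
      · exact hA.2 m hm d' d hmd' hmd hl' hl
    · intro d hd
      obtain ⟨a, ha, had, -⟩ := hp d hd
      exact hA.1 d ⟨a, ha, had⟩
  intro D D' hD hD'
  rw [← key D hD, key D' hD']

/-- A König property: a transversal that is no larger than some matching. -/
theorem IsForestHeight.exists_matching_transversal {h : V → ℕ} (hh : IsForestHeight G h)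
    (A : Finset V) (hA : ∀ a ∈ A, ∃ x, G.Adj a x) :
    ∃ M D : Set V, M ⊆ A ∧ (∀ m ∈ M, ∀ m' ∈ M, ∀ x, G.Adj m x → G.Adj m' x → m = m') ∧
      IsTransversal G A D ∧ D.encard ≤ M.encard := by
  classical
  induction A using Finset.strongInduction with
  | H A ih =>
    rcases A.eq_empty_or_nonempty with rfl | hne
    · exact ⟨∅, ∅, by simp, by simp, by simp [IsTransversal], le_rfl⟩
    obtain ⟨e, he, hmax⟩ := A.exists_max_image h hne
    -- For a highest `e` in `A`, take as `x` its neighbor that is not higher, or any neighbor if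
    -- there is none.
    obtain ⟨x, hex, hx⟩ : ∃ x, G.Adj e x ∧ ∀ y, G.Adj e y → y ≠ x → h e < h y := by
      by_cases hlow : ∃ x, G.Adj e x ∧ h x ≤ h e
      · obtain ⟨x, hex, hle⟩ := hlow
        refine ⟨x, hex, fun y hy hne => ?_⟩
        by_contra hcon
        exact hne (hh e y x hy hex (not_lt.1 hcon) hle)
      · push Not at hlow
        obtain ⟨x, hex⟩ := hA e he
        exact ⟨x, hex, fun y hy _ => hlow y hy⟩
    -- If `y ≠ x`, then `y` is higher than `e`, hence higher than `a`, and has only one neighbor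
    -- that is not higher. So hyperedges that meet `e` do so at `x`: removing all those through `x`
    -- leaves hyperedges disjoint from `e`.
    have hshare : ∀ a ∈ A, ∀ y, G.Adj e y → G.Adj a y → y ≠ x → a = e := by
      intro a ha y hey hay hne
      have h1 := hx y hey hne
      have h2 := hmax a ha
      exact hh y a e hay.symm hey.symm (by omega) (by omega)
    have hss : A.filter (fun a => ¬ G.Adj a x) ⊂ A :=
      Finset.filter_ssubset.2 ⟨e, he, by simpa using hex⟩
    obtain ⟨M, D, hMA, hM, hD, hc⟩ := ih _ hss (fun a ha => hA a (Finset.mem_filter.1 ha).1)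
    have hM' : ∀ m ∈ M, m ∈ A ∧ ¬ G.Adj m x := fun m hm => Finset.mem_filter.1 (hMA hm)
    have heM : e ∉ M := fun h => (hM' e h).2 hex
    have hdis : ∀ m ∈ M, ∀ y, G.Adj e y → ¬ G.Adj m y := by
      intro m hm y hey hmy
      by_cases hyx : y = x
      · exact (hM' m hm).2 (hyx ▸ hmy)
      · exact heM (hshare m (hM' m hm).1 y hey hmy hyx ▸ hm)
    refine ⟨insert e M, insert x D, ?_, ?_, ?_, ?_⟩
    · exact Set.insert_subset he fun m hm => (hM' m hm).1
    · rintro m (rfl | hm) m' (rfl | hm') y h1 h2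
      · rfl
      · exact (hdis m' hm' y h1 h2).elim
      · exact (hdis m hm y h2 h1).elim
      · exact hM m hm m' hm' y h1 h2
    · intro a ha
      by_cases hax : G.Adj a x
      · exact ⟨x, Set.mem_insert _ _, hax⟩
      · obtain ⟨d, hd, had⟩ := hD a (Finset.mem_coe.2 (Finset.mem_filter.2 ⟨ha, hax⟩))
        exact ⟨d, Set.mem_insert_of_mem _ hd, had⟩
    · rw [Set.encard_insert_of_notMem heM]
      exact (Set.encard_insert_le _ _).trans (by gcongr)

theorem IsForestHeight.isGrafted [Finite V] {h : V → ℕ} (hh : IsForestHeight G h) {A : Set V}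
    (h2 : HasTwoNeighbors G A) (hu : TransversalUnmixed G A) : IsGrafted G A := by
  classical
  obtain ⟨M, D₀, hMA, hM, hD₀, hc⟩ := hh.exists_matching_transversal A.toFinite.toFinset
    (fun a ha => by
      obtain ⟨x, -, -, hx, -⟩ := h2 a (by simpa using ha)
      exact ⟨x, hx⟩)
  rw [Set.Finite.coe_toFinset] at hMA hD₀
  obtain ⟨D₁, hD₁, hD₁min⟩ := hD₀.exists_min_subset
  have hcard : ∀ D, IsMinTransversal G A D → D.encard ≤ M.encard := fun D hD =>
    (hu D D₁ hD hD₁min).trans_le ((Set.encard_le_encard hD₁).trans hc)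
  -- Choosing a point of `D` in each `m ∈ M` is injective because `M` is a matching, and `D` is no
  -- larger than `M`, so the choice is a bijection.
  have hmeet : ∀ D, IsMinTransversal G A D →
      (∀ d ∈ D, ∃ m ∈ M, G.Adj m d) ∧
      ∀ m ∈ M, ∀ d ∈ D, ∀ d' ∈ D, G.Adj m d → G.Adj m d' → d = d' := by
    intro D hD
    have ht := hD.prop
    choose! f hf hf' using fun m (hm : m ∈ M) => ht m (hMA hm)
    have hinj : Set.InjOn f M := fun m hm m' hm' he =>
      hM m hm m' hm' (f m) (hf' m hm) (he ▸ hf' m' hm')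
    have himg : f '' M = D := by
      refine Set.Finite.eq_of_subset_of_encard_le (Set.toFinite _) ?_ ?_
      · rintro _ ⟨m, hm, rfl⟩
        exact hf m hm
      · rw [hinj.encard_image]
        exact hcard D hD
    have hf'' : ∀ m ∈ M, ∀ d ∈ D, G.Adj m d → d = f m := by
      intro m hm d hd hmd
      obtain ⟨m', hm', rfl⟩ := himg ▸ hd
      rw [hM m hm m' hm' _ hmd (hf' m' hm')]
    refine ⟨fun d hd => ?_, fun m hm d hd d' hd' h1 h2 => ?_⟩
    · obtain ⟨m, hm, rfl⟩ := himg ▸ hd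
      exact ⟨m, hm, hf' m hm⟩
    · rw [hf'' m hm d hd h1, hf'' m hm d' hd' h2]
  have hcover : ∀ a ∈ A, ∀ x, G.Adj a x → ∃ m ∈ M, G.Adj m x := by
    intro a ha x hax
    -- Dropping all points of `a` except `x` forces `x` into every transversal that remains. No
    -- other hyperedge is emptied, as it shares at most one point with `a`.
    have ht : IsTransversal G A {y | ¬ (G.Adj a y ∧ y ≠ x)} := by
      intro g hg
      by_cases hga : g = a
      · exact ⟨x, by simp, hga ▸ hax⟩
      · obtain ⟨p, q, hpq, hgp, hgq⟩ := h2 g hg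
        by_cases hp : G.Adj a p ∧ p ≠ x
        · refine ⟨q, fun hq => ?_, hgq⟩
          exact hga (hh.no_four_cycle hgp hgq hp.1 hq.1 hpq)
        · exact ⟨p, hp, hgp⟩
    obtain ⟨D, hDs, hD⟩ := ht.exists_min_subset
    obtain ⟨d, hd, had⟩ := hD.prop a ha
    obtain rfl : d = x := by
      by_contra hne
      exact hDs hd ⟨had, hne⟩
    exact (hmeet D hD).1 d hd
  have hone : ∀ m ∈ M, ∀ x₁ x₂, G.Adj m x₁ → G.Adj m x₂ → x₁ ≠ x₂ →
      ∀ f₁ ∈ A, ∀ f₂ ∈ A, f₁ ≠ m → f₂ ≠ m → G.Adj f₁ x₁ → G.Adj f₂ x₂ → False := by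
    intro m hm x₁ x₂ hm₁ hm₂ hne f₁ hf₁ f₂ hf₂ hn₁ hn₂ hx₁ hx₂
    have hc₁ : ¬ G.Adj f₂ x₁ := fun hc => hn₂ (hh.no_four_cycle hc hx₂ hm₁ hm₂ hne)
    have hc₂ : ¬ G.Adj f₁ x₂ := fun hc => hn₁ (hh.no_four_cycle hx₁ hc hm₁ hm₂ hne)
    -- Now both `x₁` and `x₂` are forced, which gives `m` two chosen points. A hyperedge `g` emptied
    -- by this would close a cycle of length four, or of length eight through `f₁`, `m` and `f₂`.
    have ht : IsTransversal G A {y | ¬ (G.Adj f₁ y ∧ y ≠ x₁) ∧ ¬ (G.Adj f₂ y ∧ y ≠ x₂)} := by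
      intro g hg
      by_cases hg₁ : g = f₁
      · exact ⟨x₁, by simp [hc₁], hg₁ ▸ hx₁⟩
      by_cases hg₂ : g = f₂
      · exact ⟨x₂, by simp [hc₂], hg₂ ▸ hx₂⟩
      obtain ⟨p, q, hpq, hgp, hgq⟩ := h2 g hg
      by_contra hcon
      have hcov : ∀ y, G.Adj g y → (G.Adj f₁ y ∧ y ≠ x₁) ∨ (G.Adj f₂ y ∧ y ≠ x₂) := by
        intro y hgy
        by_contra hy
        exact hcon ⟨y, not_or.1 hy, hgy⟩
      have hp := hcov p hgp
      have hq := hcov q hgq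
      rcases hp with hp | hp <;> rcases hq with hq | hq
      · exact hg₁ (hh.no_four_cycle hgp hgq hp.1 hq.1 hpq)
      · exact hh.no_eight_cycle hgp hp.1 hx₁ hm₁ hm₂ hx₂ hq.1 hgq hg₁ hp.2 hn₁ hne hn₂ hq.2
          hg₂ hpq
      · exact hh.no_eight_cycle hgq hq.1 hx₁ hm₁ hm₂ hx₂ hp.1 hgp hg₁ hq.2 hn₁ hne hn₂ hp.2
          hg₂ hpq.symm
      · exact hg₂ (hh.no_four_cycle hgp hgq hp.1 hq.1 hpq)
    obtain ⟨D, hDs, hD⟩ := ht.exists_min_subset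
    have hd₁ : x₁ ∈ D := by
      obtain ⟨d, hd, had⟩ := hD.prop f₁ hf₁
      by_contra hx
      exact (hDs hd).1 ⟨had, fun h => hx (h ▸ hd)⟩
    have hd₂ : x₂ ∈ D := by
      obtain ⟨d, hd, had⟩ := hD.prop f₂ hf₂
      by_contra hx
      exact (hDs hd).2 ⟨had, fun h => hx (h ▸ hd)⟩
    exact hne ((hmeet D hD).2 m hm x₁ hd₁ x₂ hd₂ hm₁ hm₂)
  have hother : ∀ m ∈ M, ∀ x, G.Adj m x → ¬ IsLeafFor G A x → ∃ f ∈ A, f ≠ m ∧ G.Adj f x := by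
    intro m hm x hmx hl
    by_contra hcon
    push Not at hcon
    refine hl ⟨m, ⟨hMA hm, hmx⟩, ?_⟩
    rintro f ⟨hf, hfx⟩
    by_contra hne
    exact hcon f hf hne hfx
  have hone' : ∀ m ∈ M, ∀ x y, G.Adj m x → G.Adj m y →
      ¬ IsLeafFor G A x → ¬ IsLeafFor G A y → x = y := by
    intro m hm x y hx hy hlx hly
    obtain ⟨f₁, hf₁, hn₁, ha₁⟩ := hother m hm x hx hlx
    obtain ⟨f₂, hf₂, hn₂, ha₂⟩ := hother m hm y hy hly
    by_contra hne
    exact hone m hm x y hx hy hne f₁ hf₁ f₂ hf₂ hn₁ hn₂ ha₁ ha₂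
  -- A leaf of `m` is covered by `M`, and only `m` can cover it. Conversely, `m ∈ M` has two points,
  -- of which at most one is not a leaf.
  have hpend : ∀ m, IsPendant G A m ↔ m ∈ M := by
    intro m
    constructor
    · rintro ⟨hm, l, hml, hl⟩
      obtain ⟨m', hm', hml'⟩ := hcover m hm l hml
      rwa [hl.unique ⟨hm, hml⟩ ⟨hMA hm', hml'⟩]
    · intro hm
      refine ⟨hMA hm, ?_⟩
      obtain ⟨x, y, hne, hx, hy⟩ := h2 m (hMA hm)
      by_contra hcon
      push Not at hcon
      exact hne (hone' m hm x y hx hy (hcon x hx) (hcon y hy))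
  refine ⟨?_, fun m hm => hone' m ((hpend m).1 hm)⟩
  rintro x ⟨a, ha, hax⟩
  obtain ⟨m, hm, hmx⟩ := hcover a ha x hax
  refine ⟨m, ⟨(hpend m).2 hm, hmx⟩, ?_⟩
  rintro m' ⟨hm', hmx'⟩
  exact hM m' ((hpend m').1 hm') m hm x hmx' hmx

theorem IsForestHeight.transversalUnmixed_iff [Finite V] {h : V → ℕ} (hh : IsForestHeight G h)
    {A : Set V} (h2 : HasTwoNeighbors G A) : TransversalUnmixed G A ↔ IsGrafted G A :=
  ⟨hh.isGrafted h2, IsGrafted.transversalUnmixed⟩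

end Hypergraph

/-! ### Heights in a tree and the grafted condition -/

section Height

variable {W : Type*} {K : SimpleGraph W}

theorem isLeaf_iff {v : W} : IsLeaf K v ↔ ∃! u, K.Adj v u := by
  unfold IsLeaf
  rw [Set.encard_eq_one]
  constructor
  · rintro ⟨x, hx⟩
    exact ⟨x, (Set.ext_iff.1 hx x).2 rfl, fun y hy => (Set.ext_iff.1 hx y).1 hy⟩
  · rintro ⟨x, hx, hu⟩
    exact ⟨x, Set.ext fun y => ⟨fun hy => hu y hy, fun hy => hy ▸ hx⟩⟩

theorem isIsolated_iff {v : W} : IsIsolated K v ↔ ∀ u, ¬ K.Adj v u := by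
  unfold IsIsolated
  rw [Set.encard_eq_zero, Set.eq_empty_iff_forall_notMem]
  rfl

/-- Some leaf has distance at most `n` from `v`. -/
def HasLeafWithin (K : SimpleGraph W) (n : ℕ) (v : W) : Prop :=
  ∃ l, IsLeaf K l ∧ K.edist v l ≤ n

theorem height_le_iff {v : W} {n : ℕ} :
    height K v ≤ n ↔ IsIsolated K v ∨ HasLeafWithin K n v := by
  unfold height HasLeafWithin
  split_ifs with hi
  · simp [hi]
  -- The strict form lets `iInf_lt_iff` extract a leaf that witnesses the bound.
  · have hlt : ∀ x : ℕ∞, x ≤ n ↔ x < n + 1 := fun x =>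
      (ENat.lt_add_one_iff (ENat.natCast_ne_top n)).symm
    simp only [hlt, iInf_lt_iff, hi, false_or, exists_prop, Set.mem_ofPred_eq]

theorem edist_le_succ_iff {v l : W} {n : ℕ} :
    K.edist v l ≤ (n + 1 : ℕ) ↔ v = l ∨ ∃ u, K.Adj v u ∧ K.edist u l ≤ n := by
  constructor
  · intro h
    obtain ⟨p, hp⟩ := SimpleGraph.exists_walk_of_edist_ne_top
      (ne_top_of_le_ne_top (ENat.natCast_ne_top _) h)
    rw [← hp] at h
    cases p with
    | nil => exact Or.inl rfl
    | cons hadj q =>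
      refine Or.inr ⟨_, hadj, (SimpleGraph.edist_le q).trans ?_⟩
      rw [SimpleGraph.Walk.length_cons] at h
      exact_mod_cast Nat.le_of_succ_le_succ (by exact_mod_cast h)
  · rintro (rfl | ⟨u, hvu, hul⟩)
    · simp
    · refine (SimpleGraph.edist_triangle (v := u)).trans ?_
      rw [SimpleGraph.edist_eq_one_iff_adj.2 hvu, add_comm]
      push_cast
      gcongr

theorem hasLeafWithin_zero {v : W} : HasLeafWithin K 0 v ↔ IsLeaf K v := by
  simp only [HasLeafWithin, Nat.cast_zero, nonpos_iff_eq_zero, SimpleGraph.edist_eq_zero_iff,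
    exists_eq_right']

theorem hasLeafWithin_succ {v : W} {n : ℕ} :
    HasLeafWithin K (n + 1) v ↔ IsLeaf K v ∨ ∃ u, K.Adj v u ∧ HasLeafWithin K n u := by
  simp only [HasLeafWithin, edist_le_succ_iff]
  constructor
  · rintro ⟨l, hl, rfl | ⟨u, hu, hul⟩⟩
    · exact Or.inl hl
    · exact Or.inr ⟨u, hu, l, hl, hul⟩
  · rintro (hv | ⟨u, hu, l, hl, hul⟩)
    · exact ⟨v, hv, Or.inl rfl⟩
    · exact ⟨l, hl, Or.inr ⟨u, hu, hul⟩⟩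

theorem mem_level_succ_iff {v : W} {n : ℕ} :
    v ∈ level K (n + 1) ↔
      ¬ IsIsolated K v ∧ HasLeafWithin K (n + 1) v ∧ ¬ HasLeafWithin K n v := by
  have h : v ∈ level K (n + 1) ↔ height K v ≤ (n + 1 : ℕ) ∧ ¬ height K v ≤ n := by
    change height K v = _ ↔ _
    rw [not_le, le_antisymm_iff]
    push_cast
    rw [ENat.add_one_le_iff (ENat.natCast_ne_top n)]
  rw [h, height_le_iff, height_le_iff]
  tauto

theorem mem_level_one_iff {v : W} :
    v ∈ level K 1 ↔ ¬ IsLeaf K v ∧ ∃ l, K.Adj v l ∧ IsLeaf K l := by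
  rw [show 1 = 0 + 1 from rfl, mem_level_succ_iff, hasLeafWithin_succ]
  simp only [hasLeafWithin_zero, isIsolated_iff]
  constructor
  · rintro ⟨-, h2, h3⟩
    exact ⟨h3, h2.resolve_left h3⟩
  · rintro ⟨h1, l, hvl, hl⟩
    exact ⟨fun h => h l hvl, Or.inr ⟨l, hvl, hl⟩, h1⟩

theorem mem_level_two_iff {v : W} :
    v ∈ level K 2 ↔ ¬ IsLeaf K v ∧ (∀ l, K.Adj v l → ¬ IsLeaf K l) ∧
      ∃ m, K.Adj v m ∧ ∃ l, K.Adj m l ∧ IsLeaf K l := by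
  rw [show 2 = 1 + 1 from rfl, mem_level_succ_iff, hasLeafWithin_succ,
    show 1 = 0 + 1 from rfl]
  simp only [hasLeafWithin_succ, hasLeafWithin_zero, isIsolated_iff]
  constructor
  · rintro ⟨-, h2, h3⟩
    push Not at h3
    obtain ⟨m, hm, h⟩ := h2.resolve_left h3.1
    exact ⟨h3.1, h3.2, m, hm, h.resolve_left (h3.2 m hm)⟩
  · rintro ⟨h1, h2, m, hm, l, hml, hl⟩
    refine ⟨fun h => h m hm, Or.inr ⟨m, hm, Or.inr ⟨l, hml, hl⟩⟩, ?_⟩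
    rintro (h | ⟨l, hvl, hl⟩)
    · exact h1 h
    · exact h2 l hvl hl

theorem height_ne_top [Finite W] (hK : K.IsTree) (v : W) : height K v ≠ ⊤ := by
  classical
  have := Fintype.ofFinite W
  suffices ∃ n : ℕ, height K v ≤ n by
    obtain ⟨n, hn⟩ := this
    exact ne_top_of_le_ne_top (ENat.natCast_ne_top n) hn
  rcases subsingleton_or_nontrivial W with _ | _
  · exact ⟨0, height_le_iff.2 (Or.inl (isIsolated_iff.2 fun u hu =>
      hu.ne (Subsingleton.elim _ _)))⟩
  · obtain ⟨l, hl⟩ := hK.exists_vert_degree_one_of_nontrivial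
    rw [SimpleGraph.degree_eq_one_iff_existsUnique_adj] at hl
    exact ⟨K.dist v l, height_le_iff.2 (Or.inr ⟨l, isLeaf_iff.2 hl,
      ((hK.connected v l).coe_dist_eq_edist).ge⟩)⟩

/-- The supremum of an unbounded set in `ℕ` is `0` by convention, and vertices of height `⊤` lie in
no level. Neither occurs in a finite tree. -/
theorem graphHeight_le_iff [Finite W] (hK : K.IsTree) {n : ℕ} :
    graphHeight K ≤ n ↔ ∀ v, height K v ≤ n := by
  have hmem : ∀ v, (height K v).toNat ∈ {k | (level K k).Nonempty} := fun v =>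
    ⟨v, (ENat.natCast_toNat (height_ne_top hK v)).symm⟩
  constructor
  · intro h v
    have hbdd : BddAbove {k | (level K k).Nonempty} := by
      refine ((Set.finite_range fun v => (height K v).toNat).subset ?_).bddAbove
      rintro k ⟨v, hv⟩
      exact ⟨v, by simp only [show height K v = k from hv, ENat.toNat_natCast]⟩
    rw [← ENat.natCast_toNat (height_ne_top hK v)]
    exact_mod_cast (le_csSup hbdd (hmem v)).trans h
  · intro h
    obtain ⟨v⟩ := hK.connected.nonempty
    refine csSup_le ⟨_, hmem v⟩ ?_
    rintro k ⟨w, hw⟩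
    have := h w
    rw [show height K w = k from hw] at this
    exact_mod_cast this

/-- `A` is one side of a bipartition. -/
def IsSide (K : SimpleGraph W) (A : Set W) : Prop :=
  ∀ v w, K.Adj v w → (v ∈ A ↔ w ∉ A)

variable {A : Set W}

theorem HasTwoNeighbors.not_mem_of_isLeaf (h2 : HasTwoNeighbors K A) {v : W}
    (hv : IsLeaf K v) : v ∉ A := fun hA => by
  obtain ⟨x, y, hne, hx, hy⟩ := h2 v hA
  exact hne ((isLeaf_iff.1 hv).unique hx hy)

theorem isLeafFor_iff_isLeaf (hs : IsSide K A) (h2 : HasTwoNeighbors K A) {x : W} :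
    IsLeafFor K A x ↔ IsLeaf K x := by
  rw [isLeaf_iff]
  constructor
  · rintro ⟨a, ⟨ha, hax⟩, hu⟩
    have hx := (hs a x hax).1 ha
    refine ⟨a, hax.symm, fun b hb => hu b ⟨?_, hb.symm⟩⟩
    exact (hs b x hb.symm).2 hx
  · rintro ⟨a, hax, hu⟩
    have hx := h2.not_mem_of_isLeaf (isLeaf_iff.2 ⟨a, hax, hu⟩)
    exact ⟨a, ⟨(hs a x hax.symm).2 hx, hax.symm⟩, fun b hb => hu b hb.2.symm⟩

theorem isPendant_iff_mem_level (hs : IsSide K A) (h2 : HasTwoNeighbors K A) {m : W} :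
    IsPendant K A m ↔ m ∈ level K 1 := by
  simp only [IsPendant, isLeafFor_iff_isLeaf hs h2, mem_level_one_iff]
  constructor
  · rintro ⟨hm, h⟩
    exact ⟨fun hl => h2.not_mem_of_isLeaf hl hm, h⟩
  · rintro ⟨-, l, hml, hl⟩
    exact ⟨(hs m l hml).2 (h2.not_mem_of_isLeaf hl), l, hml, hl⟩

/-- All leaves lie outside `A`, so the neighbors of leaves lie in `A`. A neighbor of such a vertex
is outside `A` and cannot be adjacent to a leaf. -/
theorem mem_level_two_iff_of_isSide (hs : IsSide K A) (h2 : HasTwoNeighbors K A) {v : W} :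
    v ∈ level K 2 ↔ ¬ IsLeaf K v ∧ ∃ m ∈ level K 1, K.Adj m v := by
  rw [mem_level_two_iff]
  have hmem : ∀ m l, K.Adj m l → IsLeaf K l → m ∈ A := fun m l hml hl =>
    (hs m l hml).2 (h2.not_mem_of_isLeaf hl)
  constructor
  · rintro ⟨h1, -, m, hvm, l, hml, hl⟩
    exact ⟨h1, m, mem_level_one_iff.2 ⟨fun h => h2.not_mem_of_isLeaf h (hmem m l hml hl),
      l, hml, hl⟩, hvm.symm⟩
  · rintro ⟨h1, m, hm, hmv⟩
    obtain ⟨-, l, hml, hl⟩ := mem_level_one_iff.1 hm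
    refine ⟨h1, fun a hva ha => ?_, m, hmv.symm, l, hml, hl⟩
    exact (hs m v hmv).1 (hmem m l hml hl) (hmem v a hva ha)

/-- Leaves lie outside `A`, so by parity a non-isolated vertex outside `A` with height at most 3 has
height at most 2. The vertices of `A` are then one step further at most. -/
theorem forall_height_le_three_iff (hs : IsSide K A) (h2 : HasTwoNeighbors K A) :
    (∀ v, height K v ≤ (3 : ℕ)) ↔
      ∀ x, (∃ a ∈ A, K.Adj a x) → IsLeaf K x ∨ ∃ m ∈ level K 1, K.Adj m x := by
  have hleaf := fun v (hv : IsLeaf K v) => h2.not_mem_of_isLeaf hv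
  simp only [height_le_iff, show 3 = 0 + 1 + 1 + 1 from rfl, hasLeafWithin_succ,
    hasLeafWithin_zero]
  constructor
  · rintro h x ⟨a, ha, hax⟩
    have hx := (hs a x hax).1 ha
    have hA : ∀ u, K.Adj x u → u ∈ A := fun u hu => (hs u x hu.symm).2 hx
    rcases h x with hi | hl | ⟨u, hu, hl | ⟨w, hw, hl | ⟨l, hwl, hl⟩⟩⟩
    · exact (isIsolated_iff.1 hi a hax.symm).elim
    · exact Or.inl hl
    · exact (hleaf u hl (hA u hu)).elim
    · exact Or.inr ⟨u, mem_level_one_iff.2 ⟨fun hl' => hleaf u hl' (hA u hu), w, hw, hl⟩,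
        hu.symm⟩
    · exact ((hs u w hw).1 (hA u hu) ((hs w l hwl).2 (hleaf l hl))).elim
  · intro h
    have h' : ∀ x, (∃ a ∈ A, K.Adj a x) → IsLeaf K x ∨
        ∃ u, K.Adj x u ∧ (IsLeaf K u ∨ ∃ l, K.Adj u l ∧ IsLeaf K l) := by
      intro x hx
      rcases h x hx with hl | ⟨m, hm, hmx⟩
      · exact Or.inl hl
      · exact Or.inr ⟨m, hmx.symm, Or.inr (mem_level_one_iff.1 hm).2⟩
    intro v
    by_cases hv : v ∈ A
    · obtain ⟨x, -, -, hvx, -⟩ := h2 v hv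
      exact Or.inr (Or.inr ⟨x, hvx, h' x ⟨v, hv, hvx⟩⟩)
    by_cases hi : IsIsolated K v
    · exact Or.inl hi
    rw [isIsolated_iff] at hi
    push Not at hi
    obtain ⟨a, hva⟩ := hi
    rcases h' v ⟨a, (hs a v hva.symm).2 hv, hva.symm⟩ with hl | ⟨u, hu, hl⟩
    · exact Or.inr (Or.inl hl)
    · refine Or.inr (Or.inr ⟨u, hu, hl.imp_right ?_⟩)
      rintro ⟨l, hul, hl⟩
      exact ⟨l, hul, Or.inl hl⟩

/-- Pendant vertices are those of height 1, and their non-leaf neighbors are those of height 2. The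
height bound supplies a pendant neighbor of each point, the second condition its uniqueness; for a
leaf both are automatic. -/
theorem isGrafted_iff_level [Finite W] (hK : K.IsTree) (hs : IsSide K A)
    (h2 : HasTwoNeighbors K A) :
    IsGrafted K A ↔ graphHeight K ≤ 3 ∧
      (∀ v ∈ level K 2, (K.neighborSet v ∩ level K 1).encard = 1) ∧
      (∀ v ∈ level K 1, (K.neighborSet v ∩ level K 2).encard ≤ 1) := by
  rw [graphHeight_le_iff hK, forall_height_le_three_iff hs h2]
  have hl1 : ∀ m ∈ level K 1, m ∈ A := fun m hm => ((isPendant_iff_mem_level hs h2).2 hm).1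
  simp only [IsGrafted, isPendant_iff_mem_level hs h2, isLeafFor_iff_isLeaf hs h2,
    Set.encard_eq_one, Set.encard_le_one_iff]
  constructor
  · rintro ⟨h3, h4⟩
    refine ⟨fun x hx => ?_, fun v hv => ?_, fun v hv x y hx hy => ?_⟩
    · obtain ⟨m, hm, -⟩ := h3 x hx
      exact Or.inr ⟨m, hm⟩
    · obtain ⟨-, m, hm, hmv⟩ := (mem_level_two_iff_of_isSide hs h2).1 hv
      refine ⟨m, Set.ext fun m' => ⟨fun h => ?_, ?_⟩⟩
      · exact (h3 v ⟨m, hl1 m hm, hmv⟩).unique ⟨h.2, SimpleGraph.Adj.symm h.1⟩ ⟨hm, hmv⟩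
      · rintro rfl
        exact ⟨hmv.symm, hm⟩
    · exact h4 v hv x y hx.1 hy.1 ((mem_level_two_iff_of_isSide hs h2).1 hx.2).1
        ((mem_level_two_iff_of_isSide hs h2).1 hy.2).1
  · rintro ⟨h3, h4, h5⟩
    refine ⟨fun x hx => ?_, fun m hm x y hx hy hlx hly => ?_⟩
    · by_cases hl : IsLeaf K x
      · obtain ⟨a, ha, hax⟩ := hx
        refine ⟨a, ⟨mem_level_one_iff.2 ⟨fun h => h2.not_mem_of_isLeaf h ha, x, hax, hl⟩, hax⟩,
          fun b hb => (isLeaf_iff.1 hl).unique hb.2.symm hax.symm⟩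
      · obtain ⟨m, hm, hmx⟩ := (h3 x hx).resolve_left hl
        obtain ⟨n, hn⟩ := h4 x ((mem_level_two_iff_of_isSide hs h2).2 ⟨hl, m, hm, hmx⟩)
        have hn' : ∀ k, K.Adj k x → k ∈ level K 1 → k = n := fun k hk hk' =>
          (Set.ext_iff.1 hn k).1 ⟨hk.symm, hk'⟩
        exact ⟨m, ⟨hm, hmx⟩, fun k hk => (hn' k hk.2 hk.1).trans (hn' m hmx hm).symm⟩
    · exact h5 m hm x y ⟨hx, (mem_level_two_iff_of_isSide hs h2).2 ⟨hlx, m, hm, hx⟩⟩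
        ⟨hy, (mem_level_two_iff_of_isSide hs h2).2 ⟨hly, m, hm, hy⟩⟩

end Height

/-! ### Restriction to pieces of the graph -/

section Transfer

variable {V : Type*} {G : SimpleGraph V} {A : Set V} {W : Type*} {K : SimpleGraph W}

/-- The embedded graph contains all neighbors of its vertices along edges that meet `A`. -/
def IsClosedEmbedding (φ : K ↪g G) (A : Set V) : Prop :=
  ∀ w v, G.Adj (φ w) v → (v ∈ A ∨ φ w ∈ A) → ∃ w', φ w' = v

namespace IsClosedEmbedding

variable {φ : K ↪g G} (hφ : IsClosedEmbedding φ A)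

include hφ

theorem hasTwoNeighbors (h2 : HasTwoNeighbors G A) : HasTwoNeighbors K (φ ⁻¹' A) := by
  intro a ha
  obtain ⟨x, y, hne, hx, hy⟩ := h2 (φ a) ha
  obtain ⟨x, rfl⟩ := hφ a x hx (Or.inr ha)
  obtain ⟨y, rfl⟩ := hφ a y hy (Or.inr ha)
  exact ⟨x, y, fun h => hne (h ▸ rfl), φ.map_adj_iff.1 hx, φ.map_adj_iff.1 hy⟩

theorem isLeafFor_iff {x : W} : IsLeafFor K (φ ⁻¹' A) x ↔ IsLeafFor G A (φ x) := by
  constructor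
  · rintro ⟨a, ⟨ha, hax⟩, hu⟩
    refine ⟨φ a, ⟨ha, φ.map_adj_iff.2 hax⟩, ?_⟩
    rintro b ⟨hb, hbx⟩
    obtain ⟨b, rfl⟩ := hφ x b hbx.symm (Or.inl hb)
    rw [hu b ⟨hb, φ.map_adj_iff.1 hbx⟩]
  · rintro ⟨a, ⟨ha, hax⟩, hu⟩
    obtain ⟨a, rfl⟩ := hφ x a hax.symm (Or.inl ha)
    exact ⟨a, ⟨ha, φ.map_adj_iff.1 hax⟩,
      fun b hb => φ.injective (hu (φ b) ⟨hb.1, φ.map_adj_iff.2 hb.2⟩)⟩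

theorem isPendant_iff {m : W} : IsPendant K (φ ⁻¹' A) m ↔ IsPendant G A (φ m) := by
  constructor
  · rintro ⟨hm, l, hml, hl⟩
    exact ⟨hm, φ l, φ.map_adj_iff.2 hml, hφ.isLeafFor_iff.1 hl⟩
  · rintro ⟨hm, l, hml, hl⟩
    obtain ⟨l, rfl⟩ := hφ m l hml (Or.inr hm)
    exact ⟨hm, l, φ.map_adj_iff.1 hml, hφ.isLeafFor_iff.2 hl⟩

end IsClosedEmbedding

/-- The grafted condition involves only edges that meet `A`, and each of these stays inside one
piece. -/
theorem isGrafted_iff_forall {ι : Type*} {W : ι → Type*} {K : ∀ i, SimpleGraph (W i)}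
    {φ : ∀ i, K i ↪g G} (hφ : ∀ i, IsClosedEmbedding (φ i) A)
    (hcov : ∀ a ∈ A, ∃ i w, φ i w = a) :
    IsGrafted G A ↔ ∀ i, IsGrafted (K i) (φ i ⁻¹' A) := by
  constructor
  · rintro ⟨h1, h2⟩ i
    refine ⟨?_, fun m hm x y hx hy hlx hly => ?_⟩
    · rintro x ⟨a, ha, hax⟩
      obtain ⟨m, ⟨hm, hmx⟩, hu⟩ := h1 (φ i x) ⟨φ i a, ha, (φ i).map_adj_iff.2 hax⟩
      obtain ⟨m, rfl⟩ := hφ i x m hmx.symm (Or.inl hm.1)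
      exact ⟨m, ⟨(hφ i).isPendant_iff.2 hm, (φ i).map_adj_iff.1 hmx⟩, fun n hn =>
        (φ i).injective (hu _ ⟨(hφ i).isPendant_iff.1 hn.1, (φ i).map_adj_iff.2 hn.2⟩)⟩
    · exact (φ i).injective (h2 _ ((hφ i).isPendant_iff.1 hm) _ _ ((φ i).map_adj_iff.2 hx)
        ((φ i).map_adj_iff.2 hy) (fun h => hlx ((hφ i).isLeafFor_iff.2 h))
        (fun h => hly ((hφ i).isLeafFor_iff.2 h)))
  · intro h
    refine ⟨?_, fun m hm x y hx hy hlx hly => ?_⟩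
    · rintro x ⟨a, ha, hax⟩
      obtain ⟨i, a, rfl⟩ := hcov a ha
      obtain ⟨x, rfl⟩ := hφ i a x hax (Or.inr ha)
      obtain ⟨m, ⟨hm, hmx⟩, hu⟩ := (h i).1 x ⟨a, ha, (φ i).map_adj_iff.1 hax⟩
      refine ⟨φ i m, ⟨(hφ i).isPendant_iff.1 hm, (φ i).map_adj_iff.2 hmx⟩, ?_⟩
      rintro n ⟨hn, hnx⟩
      obtain ⟨n, rfl⟩ := hφ i x n hnx.symm (Or.inl hn.1)
      rw [hu n ⟨(hφ i).isPendant_iff.2 hn, (φ i).map_adj_iff.1 hnx⟩]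
    · obtain ⟨i, m, rfl⟩ := hcov m hm.1
      obtain ⟨x, rfl⟩ := hφ i m x hx (Or.inr hm.1)
      obtain ⟨y, rfl⟩ := hφ i m y hy (Or.inr hm.1)
      rw [(h i).2 m ((hφ i).isPendant_iff.2 hm) x y ((φ i).map_adj_iff.1 hx)
        ((φ i).map_adj_iff.1 hy) (fun h => hlx ((hφ i).isLeafFor_iff.1 h))
        (fun h => hly ((hφ i).isLeafFor_iff.1 h))]

end Transfer

/-! ### Total domination and the interior graphs -/

section Interior

variable {V : Type*} {T : SimpleGraph V} {χ : T.Coloring Color} {c : Color}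

theorem Color.eq_of_ne {a b c : Color} (ha : a ≠ c) (hb : b ≠ c) : a = b := by
  cases a <;> cases b <;> cases c <;> simp_all

theorem coloring_eq_iff_ne {v w : V} (h : T.Adj v w) : χ v ≠ c ↔ χ w = c := by
  constructor
  · intro hv
    by_contra hw
    exact χ.valid h (Color.eq_of_ne hv hw)
  · rintro rfl
    exact χ.valid h

theorem isTDSet_iff {D : Set V} : IsTDSet T D ↔ IsTransversal T Set.univ D := by
  simp only [IsTDSet, openNbhd, Set.eq_univ_iff_forall, Set.mem_iUnion, exists_prop,
    SimpleGraph.mem_neighborSet, IsTransversal, Set.mem_univ, true_imp_iff, T.adj_comm]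

theorem isMinimalTDSet_iff {D : Set V} : IsMinimalTDSet T D ↔ IsMinTransversal T Set.univ D := by
  simp only [IsMinimalTDSet, IsMinTransversal, Minimal, isTDSet_iff]

theorem mem_interiorSet_iff {v : V} : v ∈ interiorSet χ c ↔
    ¬ (v ∈ level T 1 ∧ χ v = c) ∧ ∀ s ∈ level T 1, χ s = c → ¬ T.Adj s v := by
  simp only [interiorSet, closedNbhd, openNbhd, Set.mem_compl_iff, Set.mem_union,
    Set.mem_iUnion, Set.mem_inter_iff, Set.mem_preimage, Set.mem_singleton_iff,
    SimpleGraph.mem_neighborSet, exists_prop, not_or, not_exists, not_and]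
  tauto

/-- The vertices of the interior graph of color `c` that have the other color. -/
def interiorEdges (χ : T.Coloring Color) (c : Color) : Set V :=
  {v | χ v ≠ c ∧ ∀ s ∈ level T 1, χ s = c → ¬ T.Adj s v}

/-- The vertices of the interior graph of color `c` that have color `c`. -/
def interiorPoints (χ : T.Coloring Color) (c : Color) : Set V :=
  {v | χ v = c ∧ v ∉ level T 1}

theorem mem_interiorEdges_iff {v : V} :
    v ∈ interiorEdges χ c ↔ v ∈ interiorSet χ c ∧ χ v ≠ c := by
  rw [mem_interiorSet_iff, interiorEdges, Set.mem_ofPred_eq]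
  tauto

theorem mem_interiorPoints_of_adj {a x : V} (ha : a ∈ interiorEdges χ c) (hax : T.Adj a x) :
    x ∈ interiorPoints χ c := by
  have hx := (coloring_eq_iff_ne hax).1 ha.1
  exact ⟨hx, fun hs => ha.2 x hs hx hax.symm⟩

theorem mem_interiorSet_of_mem_interiorPoints {x : V} (hx : x ∈ interiorPoints χ c) :
    x ∈ interiorSet χ c :=
  mem_interiorSet_iff.2 ⟨fun h => hx.2 h.1, fun _ _ hs hsx =>
    (coloring_eq_iff_ne hsx).2 hx.1 hs⟩

theorem IsLeaf.mem_level_one_of_adj (hleaf : ∀ u v, T.Adj u v → IsLeaf T u → ¬ IsLeaf T v)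
    {l s : V} (hl : IsLeaf T l) (hls : T.Adj l s) : s ∈ level T 1 :=
  mem_level_one_iff.2 ⟨hleaf l s hls hl, l, hls.symm, hl⟩

/-- A leaf is excluded from the hyperedges because its neighbor has height 1 and color `c`. -/
theorem hasTwoNeighbors_interiorEdges (hiso : ∀ v, ∃ u, T.Adj v u)
    (hleaf : ∀ u v, T.Adj u v → IsLeaf T u → ¬ IsLeaf T v) :
    HasTwoNeighbors T (interiorEdges χ c) := by
  intro a ha
  obtain ⟨x, hx⟩ := hiso a
  by_contra hcon
  push Not at hcon
  have hl : IsLeaf T a := isLeaf_iff.2 ⟨x, hx, fun y hy => by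
    by_contra hne
    exact hcon y x hne hy hx⟩
  exact (mem_interiorPoints_of_adj ha hx).2 (hl.mem_level_one_of_adj hleaf hx)

theorem IsMinTransversal.subset_interiorPoints {D : Set V}
    (hD : IsMinTransversal T (interiorEdges χ c) D) : D ⊆ interiorPoints χ c := by
  intro d hd
  obtain ⟨a, ha, had, -⟩ := (isMinTransversal_iff.1 hD).2 d hd
  exact mem_interiorPoints_of_adj ha had

/-- Height-1 vertices are forced, with a leaf as private neighbor. A private neighbor of any other
chosen `d` is not adjacent to `V_1`, so it is a hyperedge for the color of `d`. -/
theorem isMinTransversal_univ_iff (hiso : ∀ v, ∃ u, T.Adj v u) {D : Set V} :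
    IsMinTransversal T Set.univ D ↔ level T 1 ⊆ D ∧
      ∀ c, IsMinTransversal T (interiorEdges χ c) (D ∩ interiorPoints χ c) := by
  simp only [isMinTransversal_iff, Set.mem_univ, true_and]
  constructor
  · rintro ⟨ht, hp⟩
    have hS : level T 1 ⊆ D := by
      intro s hs
      obtain ⟨-, l, hsl, hl⟩ := mem_level_one_iff.1 hs
      obtain ⟨d, hd, hld⟩ := ht l trivial
      rwa [(isLeaf_iff.1 hl).unique hsl.symm hld]
    refine ⟨hS, fun c => ⟨fun a ha => ?_, ?_⟩⟩
    · obtain ⟨d, hd, had⟩ := ht a trivial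
      exact ⟨d, ⟨hd, mem_interiorPoints_of_adj ha had⟩, had⟩
    · rintro d ⟨hd, hdc⟩
      obtain ⟨a, had, hu⟩ := hp d hd
      refine ⟨a, ⟨(coloring_eq_iff_ne had).2 hdc.1, fun s hs _ hsa => ?_⟩, had,
        fun d' hd' => hu d' hd'.1⟩
      exact hdc.2 (hu s (hS hs) hsa.symm ▸ hs)
  · rintro ⟨hS, hc⟩
    refine ⟨fun a _ => ?_, fun d hd => ?_⟩
    · obtain ⟨x, hax⟩ := hiso a
      by_cases ha : a ∈ interiorEdges χ (χ x)
      · obtain ⟨d, hd, had⟩ := (hc (χ x)).1 a ha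
        exact ⟨d, hd.1, had⟩
      · by_contra hcon
        -- A vertex with the right color fails to be a hyperedge only when it is adjacent to `V_1`,
        -- and then `V_1` dominates it.
        exact ha ⟨χ.valid hax, fun s hs _ hsa => hcon ⟨s, hS hs, hsa.symm⟩⟩
    · by_cases hd1 : d ∈ level T 1
      · obtain ⟨-, l, hdl, hl⟩ := mem_level_one_iff.1 hd1
        exact ⟨l, hdl.symm, fun d' _ hld' => (isLeaf_iff.1 hl).unique hld' hdl.symm⟩
      · obtain ⟨a, ha, had, hu⟩ := (hc (χ d)).2 d ⟨hd, rfl, hd1⟩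
        exact ⟨a, had, fun d' hd' had' => hu d' ⟨hd', mem_interiorPoints_of_adj ha had'⟩ had'⟩

theorem encard_eq_add_interiorPoints {D : Set V} (hD : level T 1 ⊆ D) :
    D.encard = (level T 1).encard + (D ∩ interiorPoints χ Color.red).encard +
      (D ∩ interiorPoints χ Color.blue).encard := by
  rw [← Set.encard_union_eq, ← Set.encard_union_eq]
  · congr 1
    ext x
    constructor
    · intro hx
      by_cases h1 : x ∈ level T 1
      · exact Or.inl (Or.inl h1)
      · cases hc : χ x
        · exact Or.inl (Or.inr ⟨hx, hc, h1⟩)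
        · exact Or.inr ⟨hx, hc, h1⟩
    · rintro ((h | h) | h)
      · exact hD h
      · exact h.1
      · exact h.1
  · rw [Set.disjoint_left]
    rintro x (h | h) h'
    · exact h'.2.2 h
    · exact Color.noConfusion (h.2.1.symm.trans h'.2.1)
  · rw [Set.disjoint_left]
    exact fun x h h' => h'.2.2 h

theorem unmixed_iff_forall_transversalUnmixed [Finite V] (hiso : ∀ v, ∃ u, T.Adj v u) :
    Unmixed T ↔ ∀ c, TransversalUnmixed T (interiorEdges χ c) := by
  have hex : ∀ c, ∃ E, IsMinTransversal T (interiorEdges χ c) E := by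
    intro c
    have ht : IsTransversal T (interiorEdges χ c) Set.univ := fun a _ => by
      obtain ⟨x, hx⟩ := hiso a
      exact ⟨x, trivial, hx⟩
    obtain ⟨E, -, hE⟩ := ht.exists_min_subset
    exact ⟨E, hE⟩
  have hinter : ∀ E : Color → Set V, (∀ c, IsMinTransversal T (interiorEdges χ c) (E c)) →
      ∀ c, (level T 1 ∪ ⋃ k, E k) ∩ interiorPoints χ c = E c := by
    intro E hE c
    ext x
    constructor
    · rintro ⟨h | h, hx⟩
      · exact (hx.2 h).elim
      · obtain ⟨k, hk⟩ := Set.mem_iUnion.1 h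
        have := ((hE k).subset_interiorPoints hk).1
        rwa [← hx.1, this]
    · intro hx
      exact ⟨Or.inr (Set.mem_iUnion.2 ⟨c, hx⟩), (hE c).subset_interiorPoints hx⟩
  have hunion : ∀ E : Color → Set V, (∀ c, IsMinTransversal T (interiorEdges χ c) (E c)) →
      IsMinimalTDSet T (level T 1 ∪ ⋃ k, E k) ∧ (level T 1 ∪ ⋃ k, E k).encard =
        (level T 1).encard + (E Color.red).encard + (E Color.blue).encard := by
    intro E hE
    refine ⟨isMinimalTDSet_iff.2 ((isMinTransversal_univ_iff (χ := χ) hiso).2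
      ⟨Set.subset_union_left, fun c => ?_⟩), ?_⟩
    · rw [hinter E hE c]
      exact hE c
    · rw [encard_eq_add_interiorPoints (χ := χ) Set.subset_union_left, hinter E hE, hinter E hE]
  constructor
  · intro hu c D D' hD hD'
    choose E hE using hex
    -- Only the part of color `c` varies; the other part is fixed and finite, so its size cancels.
    classical
    have hupd : ∀ F, IsMinTransversal T (interiorEdges χ c) F →
        ∀ k, IsMinTransversal T (interiorEdges χ k) (Function.update E c F k) := by
      intro F hF k
      by_cases hk : k = c
      · subst hk
        rwa [Function.update_self]
      · rw [Function.update_of_ne hk]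
        exact hE k
    obtain ⟨h1, h2⟩ := hunion _ (hupd D hD)
    obtain ⟨h3, h4⟩ := hunion _ (hupd D' hD')
    have h5 := hu _ _ h1 h3
    rw [h2, h4] at h5
    have hfin : ∀ s : Set V, s.encard ≠ ⊤ := fun s => s.toFinite.encard_lt_top.ne
    cases c
    · rw [Function.update_self, Function.update_self, Function.update_of_ne (by simp),
        Function.update_of_ne (by simp)] at h5
      exact (WithTop.add_left_inj (hfin _)).1 ((WithTop.add_right_inj (hfin _)).1 h5)
    · rw [Function.update_self, Function.update_self, Function.update_of_ne (by simp),
        Function.update_of_ne (by simp)] at h5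
      exact (WithTop.add_left_inj (WithTop.add_ne_top.2 ⟨hfin _, hfin _⟩)).1 h5
  · intro h D D' hD hD'
    obtain ⟨h1, h2⟩ := (isMinTransversal_univ_iff (χ := χ) hiso).1 (isMinimalTDSet_iff.1 hD)
    obtain ⟨h3, h4⟩ := (isMinTransversal_univ_iff (χ := χ) hiso).1
      (isMinimalTDSet_iff.1 hD')
    rw [encard_eq_add_interiorPoints (χ := χ) h1, encard_eq_add_interiorPoints (χ := χ) h3,
      h _ _ _ (h2 _) (h4 _), h _ _ _ (h2 _) (h4 _)]

/-- The inclusion of a component of an interior graph. -/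
def componentEmbedding (C : (interiorGraph χ c).ConnectedComponent) : C.toSimpleGraph ↪g T :=
  (SimpleGraph.Embedding.induce (G := T) (interiorSet χ c)).comp
    (SimpleGraph.Embedding.induce (G := interiorGraph χ c) C.supp)

/-- Passing to the interior graph deletes only edges of `T` without an end among the hyperedges: all
points of a hyperedge survive. -/
theorem isClosedEmbedding_componentEmbedding (C : (interiorGraph χ c).ConnectedComponent) :
    IsClosedEmbedding (componentEmbedding C) (interiorEdges χ c) := by
  intro w v hwv h
  have hv : v ∈ interiorSet χ c := by
    rcases h with h | h
    · exact (mem_interiorEdges_iff.1 h).1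
    · exact mem_interiorSet_of_mem_interiorPoints (mem_interiorPoints_of_adj h hwv)
  have hadj : (interiorGraph χ c).Adj ⟨v, hv⟩ w.1 := hwv.symm
  exact ⟨⟨⟨v, hv⟩, (SimpleGraph.ConnectedComponent.sound hadj.reachable).trans w.2⟩, rfl⟩

theorem isTree_component (hT : T.IsAcyclic) (C : (interiorGraph χ c).ConnectedComponent) :
    C.toSimpleGraph.IsTree :=
  ⟨C.connected_toSimpleGraph, (hT.induce _).induce _⟩

theorem isSide_component (C : (interiorGraph χ c).ConnectedComponent) :
    IsSide C.toSimpleGraph (componentEmbedding C ⁻¹' interiorEdges χ c) := by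
  intro v w hvw
  have h := (componentEmbedding C).map_adj_iff.2 hvw
  have hmem : ∀ u, u ∈ componentEmbedding C ⁻¹' interiorEdges χ c ↔
      χ (componentEmbedding C u) ≠ c := fun u =>
    mem_interiorEdges_iff.trans (and_iff_right u.1.2)
  rw [hmem, hmem, coloring_eq_iff_ne h, not_not]

theorem isGrafted_interiorEdges_iff :
    IsGrafted T (interiorEdges χ c) ↔ ∀ C : (interiorGraph χ c).ConnectedComponent,
      IsGrafted C.toSimpleGraph (componentEmbedding C ⁻¹' interiorEdges χ c) := by
  refine isGrafted_iff_forall (fun C => isClosedEmbedding_componentEmbedding C) fun a ha => ?_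
  have ha' := (mem_interiorEdges_iff.1 ha).1
  exact ⟨(interiorGraph χ c).connectedComponentMk ⟨a, ha'⟩, ⟨⟨a, ha'⟩, rfl⟩, rfl⟩

end Interior

/-! ### Trees with at most two vertices -/

section Degenerate

variable {V : Type*} {T : SimpleGraph V}

/-- Every vertex is the only neighbor of its neighbor, hence forced. With an isolated vertex there
is no total dominating set at all. -/
theorem unmixed_of_subsingleton_neighbors
    (h : ∀ v u w, T.Adj v u → T.Adj v w → u = w) : Unmixed T := by
  have key : ∀ D, IsMinimalTDSet T D → D = Set.univ := by
    intro D hD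
    have ht := (isMinimalTDSet_iff.1 hD).prop
    refine Set.eq_univ_of_forall fun v => ?_
    obtain ⟨w, -, hvw⟩ := ht v trivial
    obtain ⟨d, hd, hwd⟩ := ht w trivial
    rwa [h w v d hvw.symm hwd]
  intro D D' hD hD'
  rw [key D hD, key D' hD']

theorem height_eq_zero_of_subsingleton_neighbors
    (h : ∀ v u w, T.Adj v u → T.Adj v w → u = w) (v : V) : height T v = 0 := by
  have : height T v ≤ (0 : ℕ) := by
    rw [height_le_iff, hasLeafWithin_zero, isLeaf_iff, isIsolated_iff]
    by_contra hcon
    push Not at hcon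
    obtain ⟨⟨u, hu⟩, hn⟩ := hcon
    exact hn ⟨u, hu, fun w hw => h v w u hw hu⟩
  simpa using this

theorem subsingleton_neighbors_or (hT : T.Connected) :
    (∀ v u w, T.Adj v u → T.Adj v w → u = w) ∨
      (∀ v, ∃ u, T.Adj v u) ∧ ∀ u v, T.Adj u v → IsLeaf T u → ¬ IsLeaf T v := by
  rw [or_iff_not_imp_left]
  intro hcon
  push Not at hcon
  obtain ⟨v, x, y, hx, hy, hne⟩ := hcon
  have : Nontrivial V := ⟨x, y, hne⟩
  refine ⟨fun u => hT.preconnected.exists_adj_of_nontrivial u, fun a b hab ha hb => ?_⟩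
  rw [isLeaf_iff] at ha hb
  -- Two adjacent leaves form a whole component, which leaves no room for a vertex with two
  -- neighbors.
  have hclosed : ∀ u w, T.Adj u w → (u = a ∨ u = b) → (w = a ∨ w = b) := by
    rintro u w huw (rfl | rfl)
    · exact Or.inr (ha.unique huw hab)
    · exact Or.inl (hb.unique huw hab.symm)
  have hall : ∀ w, w = a ∨ w = b := by
    intro w
    obtain ⟨p⟩ := hT.preconnected w a
    induction p with
    | nil => exact Or.inl rfl
    | cons h _ ih => exact hclosed _ _ h.symm (ih hab ha hclosed)
  rcases hall v with rfl | rfl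
  · exact hne (ha.unique hx hy)
  · exact hne (hb.unique hx hy)

end Degenerate

end UnmixedTree

/-! ### The characterization of unmixed trees -/

theorem mainTheorem3 {V : Type*} [Finite V] (T : SimpleGraph V) (hT : T.IsTree)
    (χ : T.Coloring UnmixedTree.Color) :
    UnmixedTree.Unmixed T ↔
      ∀ c : UnmixedTree.Color,
        ∀ T' : (UnmixedTree.interiorGraph χ c).ConnectedComponent,
          UnmixedTree.graphHeight T'.toSimpleGraph ≤ 3 ∧
          (∀ v ∈ UnmixedTree.level T'.toSimpleGraph 2,
            (T'.toSimpleGraph.neighborSet v ∩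
              UnmixedTree.level T'.toSimpleGraph 1).encard = 1) ∧
          (∀ v ∈ UnmixedTree.level T'.toSimpleGraph 1,
            (T'.toSimpleGraph.neighborSet v ∩
              UnmixedTree.level T'.toSimpleGraph 2).encard ≤ 1) := by
  open UnmixedTree in
  rcases subsingleton_neighbors_or hT.connected with h | ⟨hiso, hleaf⟩
  -- With at most one neighbor per vertex, all heights are `0`, so both sides hold trivially.
  · refine iff_of_true (unmixed_of_subsingleton_neighbors h) fun c T' => ?_
    have h0 := height_eq_zero_of_subsingleton_neighbors (T := T'.toSimpleGraph)
      fun v u w hu hw => (componentEmbedding T').injective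
        (h _ _ _ ((componentEmbedding T').map_adj_iff.2 hu)
          ((componentEmbedding T').map_adj_iff.2 hw))
    have hlev : ∀ v k, v ∈ level T'.toSimpleGraph (k + 1) → False := by
      intro v k hv
      have := (h0 v).symm.trans hv
      exact absurd this (by exact_mod_cast (Nat.succ_ne_zero k).symm)
    refine ⟨(graphHeight_le_iff (isTree_component hT.isAcyclic T')).2 fun v => ?_,
      fun v hv => (hlev v 1 hv).elim, fun v hv => (hlev v 0 hv).elim⟩
    simp [h0 v]
  · obtain ⟨r⟩ := hT.connected.nonempty
    rw [unmixed_iff_forall_transversalUnmixed (χ := χ) hiso]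
    refine forall_congr' fun c => ?_
    have h2 := hasTwoNeighbors_interiorEdges (χ := χ) (c := c) hiso hleaf
    rw [(hT.isForestHeight_dist r).transversalUnmixed_iff h2, isGrafted_interiorEdges_iff]
    exact forall_congr' fun C => isGrafted_iff_level (isTree_component hT.isAcyclic C)
      (isSide_component C) ((isClosedEmbedding_componentEmbedding C).hasTwoNeighbors h2)
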